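/- **Theorem (Fairness regret of FairX-TS).** Consider a stochastic bandit with $K\ge 1$ arms and a measurable merit function $f:\mathbb R\to(0,\infty)$. For $\theta\in\mathbb R^K$ let $\pi_\theta$ be the fair policy $\pi_\theta(a)=f(\theta_a)/\sum_{b=1}^K f(\theta_b)$. Assume that - (minimum merit) $f(x)\ge\gamma$ for all $x\in\mathbb R$, for some constant $\gamma>0$; - (Lipschitz merit) $|f(x)-f(y)|\le L|x-y|$ for all $x,y\in\mathbb R$, for some constant $L>0$. The mean rewards $\mu^\star_1,\dots,\mu^\star_K$ are drawn independently from $\mathcal N(0,1)$. In each round $t=1,2,\dots$ the algorithm FairX-TS samples, independently of $\mu^\star$ given the history $H_t=(\pi_1,a_1,r_1,\dots,\pi_{t-1},a_{t-1},r_{t-1})$, a parameter $\mu_t$ from the posterior distribution of $\mu^\star$ given $H_t$, deploys the policy $\pi_t=\pi_{\mu_t}$, samples an arm $a_t\sim\pi_t$, and observes a reward $r_t\sim\mathcal N(\mu^\star_{a_t},1)$, drawn freshly given $\mu^\star$ and $a_t$. With $\pi^\star=\pi_{\mu^\star}$ the optimal fair policy, let $$\mathrm{BayesFR}_T=\mathbb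 E_{\mu^\star}\Big[\mathbb E\Big[\sum_{t=1}^T\sum_{a=1}^K|\pi^\star(a)-\pi_t(a)|\ \Big|\ \mu^\star\Big]\Big].$$ Then $\mathrm{BayesFR}_T=\widetilde O\big(L\sqrt{KT}/\gamma\big)$ at every horizon $T\ge 1$, where $\widetilde O$ hides logarithmic factors: there are absolute constants $C>0$ and $p\in\mathbb N$ such that, for all $K$, $f$, $\gamma$, $L$ as above and all $T\ge1$, $$\mathrm{BayesFR}_T\le C\,\frac{L\sqrt{KT}}{\gamma}\,\big(1+\log(KT)\big)^p .$$ -/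

import Mathlib

open MeasureTheory ProbabilityTheory
open scoped ENNReal

noncomputable section

namespace FairBandit

/-- A merit function: a (measurable) map sending a mean reward to a positive merit. -/
structure MeritFunction where
  toFun : ℝ → ℝ
  measurable_toFun : Measurable toFun
  pos : ∀ x, 0 < toFun x

instance : CoeFun MeritFunction (fun _ => ℝ → ℝ) := ⟨MeritFunction.toFun⟩

/-- Mean-reward parameters of the `K` arms. -/
abbrev Params (K : ℕ) : Type := Fin K → ℝ

/-- Policies: probability vectors over the `K` arms. -/
abbrev Policy (K : ℕ) : Type := stdSimplex ℝ (Fin K)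

/-- What is recorded in one round: deployed policy, selected arm, observed reward. -/
abbrev Round (K : ℕ) : Type := (Policy K × Fin K) × ℝ

/-- The history of the first `t` rounds (the history available when round `t + 1` starts). -/
abbrev History (K t : ℕ) : Type := Fin t → Round K

/-- The prior: independent standard normal mean rewards. -/
def prior (K : ℕ) : Measure (Params K) := Measure.pi (fun _ => gaussianReal 0 1)

instance (K : ℕ) : IsProbabilityMeasure (prior K) := by unfold prior; infer_instance

variable {K : ℕ}

lemma sum_merit_pos [NeZero K] (f : MeritFunction) (θ : Params K) : 0 < ∑ a, f (θ a) :=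
  Finset.sum_pos (fun a _ => f.pos (θ a)) Finset.univ_nonempty

/-- The fair policy of a parameter `θ`: exposure proportional to merit,
`π(a) = f(θ_a) / ∑_b f(θ_b)`. For the true parameter this is the optimal fair policy. -/
def fairPolicy [NeZero K] (f : MeritFunction) (θ : Params K) : Policy K :=
  ⟨fun a => f (θ a) / ∑ b, f (θ b),
    fun a => div_nonneg (f.pos (θ a)).le (sum_merit_pos f θ).le,
    by rw [← Finset.sum_div, div_self (sum_merit_pos f θ).ne']⟩

lemma measurable_fairPolicy [NeZero K] (f : MeritFunction) :
    Measurable (fairPolicy f : Params K → Policy K) := by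
  refine Measurable.subtype_mk (measurable_pi_lambda _ fun a => ?_)
  have h : ∀ b : Fin K, Measurable fun θ : Params K => f (θ b) := fun b =>
    f.measurable_toFun.comp (measurable_pi_apply b)
  exact (h a).div (Finset.measurable_sum _ fun b _ => h b)

lemma measurable_policy_apply (a : Fin K) : Measurable fun p : Policy K => p.1 a :=
  (measurable_pi_apply a).comp measurable_subtype_coe

/-- Sampling an arm from a policy. -/
def armKernel (K : ℕ) : Kernel (Policy K) (Fin K) where
  toFun p := ∑ a, ENNReal.ofReal (p.1 a) • Measure.dirac a
  measurable' := by
    refine Measure.measurable_of_measurable_coe _ fun s _ => ?_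
    simp only [Measure.coe_finsetSum, Finset.sum_apply, Measure.smul_apply, smul_eq_mul]
    exact Finset.measurable_sum _ fun a _ =>
      ((measurable_policy_apply a).ennreal_ofReal).mul_const _

instance (K : ℕ) : IsMarkovKernel (armKernel K) := by
  refine ⟨fun p => ⟨?_⟩⟩
  change (∑ a, ENNReal.ofReal (p.1 a) • Measure.dirac a : Measure (Fin K)) Set.univ = 1
  simp only [Measure.coe_finsetSum, Finset.sum_apply, Measure.smul_apply, smul_eq_mul,
    measure_univ, mul_one]
  rw [← ENNReal.ofReal_sum_of_nonneg fun a _ => p.2.1 a, p.2.2, ENNReal.ofReal_one]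

/-- The reward of arm `a` when the mean-reward vector is `θ`: distributed as `N(θ_a, 1)`. -/
def rewardKernel (K : ℕ) : Kernel (Params K × Fin K) ℝ where
  toFun x := gaussianReal (x.1 x.2) 1
  measurable' := by
    refine measurable_from_prod_countable_left fun a => ?_
    have h : Measurable fun θ : Params K => (θ a, (1 : NNReal)) :=
      (measurable_pi_apply a).prodMk measurable_const
    exact measurable_gaussianReal.comp h

instance (K : ℕ) : IsMarkovKernel (rewardKernel K) :=
  ⟨fun x => by change IsProbabilityMeasure (gaussianReal (x.1 x.2) 1); infer_instance⟩

/-- One round, given the true parameter `θ` and the history `h`: a parameter is sampled from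
`V h`, its fair policy is deployed, an arm is sampled from that policy, and a reward of that arm
is observed. -/
def roundKernel [NeZero K] (f : MeritFunction) {t : ℕ} (V : Kernel (History K t) (Params K)) :
    Kernel (Params K × History K t) (Round K) :=
  let policyK : Kernel (Params K × History K t) (Policy K) :=
    (V.map (fairPolicy f)).comap Prod.snd measurable_snd
  let armK : Kernel ((Params K × History K t) × Policy K) (Fin K) :=
    (armKernel K).comap Prod.snd measurable_snd
  let rewardK : Kernel ((Params K × History K t) × (Policy K × Fin K)) ℝ :=
    (rewardKernel K).comap (fun x => (x.1.1, x.2.2)) (by fun_prop)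
  (policyK ⊗ₖ armK) ⊗ₖ rewardK

instance [NeZero K] (f : MeritFunction) {t : ℕ} (V : Kernel (History K t) (Params K)) [IsMarkovKernel V] :
    IsMarkovKernel (roundKernel f V) := by
  have : IsMarkovKernel (V.map (fairPolicy f)) :=
    Kernel.IsMarkovKernel.map V (measurable_fairPolicy f)
  unfold roundKernel
  infer_instance

lemma measurable_snoc (t : ℕ) :
    Measurable fun x : History K t × Round K => (Fin.snoc x.1 x.2 : History K (t + 1)) := by
  refine measurable_pi_lambda _ fun i => ?_
  refine Fin.lastCases ?_ (fun j => ?_) i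
  · simpa only [Fin.snoc_last] using measurable_snd
  · simp only [Fin.snoc_castSucc]
    exact (measurable_pi_apply j).comp measurable_fst

/-- Append one more round to the history. -/
def extendKernel [NeZero K] (f : MeritFunction) {t : ℕ} (κ : Kernel (Params K) (History K t))
    (V : Kernel (History K t) (Params K)) : Kernel (Params K) (History K (t + 1)) :=
  (κ ⊗ₖ roundKernel f V).map fun x => Fin.snoc x.1 x.2

instance [NeZero K] (f : MeritFunction) {t : ℕ} (κ : Kernel (Params K) (History K t))
    (V : Kernel (History K t) (Params K)) [IsMarkovKernel κ] [IsMarkovKernel V] :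
    IsMarkovKernel (extendKernel f κ V) :=
  Kernel.IsMarkovKernel.map _ (measurable_snoc t)

/-- The conditional law, given the true parameter, of the history of the first `t` rounds, when in
round `s + 1` the learner samples a parameter from `V s` (a kernel of the past history) and deploys
its fair policy. -/
def historyKernel [NeZero K] (f : MeritFunction) (V : ∀ s, Kernel (History K s) (Params K)) :
    ∀ t, Kernel (Params K) (History K t)
  | 0 => Kernel.const _ (Measure.dirac Fin.elim0)
  | t + 1 => extendKernel f (historyKernel f V t) (V t)

instance [NeZero K] (f : MeritFunction) (V : ∀ s, Kernel (History K s) (Params K))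
    [∀ s, IsMarkovKernel (V s)] (t : ℕ) : IsMarkovKernel (historyKernel f V t) := by
  induction t with
  | zero => unfold historyKernel; infer_instance
  | succ t ih => unfold historyKernel; infer_instance

/-- FairX-TS: the kernel `V t` used in round `t + 1` is (a version of) the posterior of the true
parameter given the history of the first `t` rounds. Posteriors are determined up to
null sets of the marginal law of the history. -/
def IsFairXTS [NeZero K] (f : MeritFunction) (V : ∀ s, Kernel (History K s) (Params K))
    [∀ s, IsMarkovKernel (V s)] : Prop :=
  ∀ t, ∀ᵐ h ∂(historyKernel f V t ∘ₘ prior K),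
    V t h = posterior (historyKernel f V t) (prior K) h

/-- Auxiliary construction for `exists_isFairXTS`. -/
def posteriorHistoryKernel [NeZero K] (f : MeritFunction) :
    ∀ t, {κ : Kernel (Params K) (History K t) // IsMarkovKernel κ}
  | 0 => ⟨Kernel.const _ (Measure.dirac Fin.elim0), inferInstance⟩
  | t + 1 =>
    haveI := (posteriorHistoryKernel f t).2
    ⟨extendKernel f (posteriorHistoryKernel f t).1
      (posterior (posteriorHistoryKernel f t).1 (prior K)), inferInstance⟩

/-- FairX-TS exists for every merit function. -/
theorem exists_isFairXTS [NeZero K] (f : MeritFunction) :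
    ∃ (V : ∀ s, Kernel (History K s) (Params K)) (_ : ∀ s, IsMarkovKernel (V s)),
      IsFairXTS f V := by
  have : ∀ t, IsMarkovKernel (posteriorHistoryKernel (K := K) f t).1 :=
    fun t => (posteriorHistoryKernel f t).2
  let V : ∀ s, Kernel (History K s) (Params K) :=
    fun s => posterior (posteriorHistoryKernel f s).1 (prior K)
  have hV : ∀ s, IsMarkovKernel (V s) := fun s => by unfold V; infer_instance
  have key : ∀ t, historyKernel f V t = (posteriorHistoryKernel f t).1 := by
    intro t
    induction t with
    | zero => rfl
    | succ t ih => simp only [historyKernel, ih]; rfl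
  refine ⟨V, hV, fun t => Filter.Eventually.of_forall fun h => ?_⟩
  simp only [key, V]

/-- The fairness regret after `T` rounds: the cumulative `ℓ¹` distance between the optimal fair
policy and the deployed policies. -/
def fairnessRegret [NeZero K] (f : MeritFunction) {T : ℕ} (θ : Params K) (h : History K T) : ℝ :=
  ∑ t, ∑ a, |(fairPolicy f θ).1 a - (h t).1.1.1 a|

/-- The Bayesian fairness regret after `T` rounds: the expectation of the (nonnegative) fairness
regret over the true parameter, drawn from the prior, and over the history given that parameter. -/
def bayesFairnessRegret [NeZero K] (f : MeritFunction) (V : ∀ s, Kernel (History K s) (Params K)) (T : ℕ) :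
    ℝ≥0∞ :=
  ∫⁻ θ, ∫⁻ h, ENNReal.ofReal (fairnessRegret f θ h) ∂(historyKernel f V T θ) ∂(prior K)

end FairBandit

end

/-! Given the history, the sampled parameter and the true one have the same law
(`IsFairXTS.lintegral_sample`). The triangle inequality through the fair policy of any
history-measurable estimate `m` therefore bounds the regret of a round by twice the expected `ℓ¹`
distance from the optimal policy to that of `m`. Here `m` is `posteriorMean`; only its dependence on
the history alone and the concentration of the truth around it are used.

Lipschitz and minimum merit turn this distance into `2L/γ` times the average of `|θ a - m a|` under
the optimal policy (`sum_abs_fairPolicy_sub_le`). With `n` the number of pulls of an arm, AM-GM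
splits each error into `ε (n + 1) |θ a - m a|² / 2` and `1 / (2ε (n + 1))`
(`abs_sub_posteriorMean_le`).

The squared part is logarithmic in expectation: it is controlled by the logarithm of the
method-of-mixtures martingale `mixture`, whose mean is exactly 1 (`lintegral_mixture`). In the other
part, posterior sampling replaces the optimal policy by the deployed one, so the mean of `1 / (n +
1)` is the expected growth of `harmonicPotential`; it telescopes to at most `K (1 + log T)`. The
choice `ε = √(K / T)` balances the two contributions. -/

namespace FairBandit

/-! ### Gaussian integrals for the method of mixtures -/

section Gaussian

/-- One Gaussian step preserves the Gaussian mixture `v ↦ exp (y² / (2 v)) / √v`. -/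
lemma lintegral_gaussianReal_exp_sq_div (y v : ℝ) (hv : 0 < v) :
    ∫⁻ x, ENNReal.ofReal (Real.exp ((y + x) ^ 2 / (2 * (v + 1))) / √(v + 1)) ∂gaussianReal 0 1
      = ENNReal.ofReal (Real.exp (y ^ 2 / (2 * v)) / √v) := by
  have hv1 : 0 < v + 1 := by linarith
  let w : NNReal := ⟨(v + 1) / v, by positivity⟩
  have hwv : (w : ℝ) = (v + 1) / v := rfl
  have hw : w ≠ 0 := by
    intro h
    have h0 : (w : ℝ) = 0 := by rw [h]; rfl
    rw [hwv] at h0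
    have : 0 < (v + 1) / v := by positivity
    linarith
  -- Completing the square: the integrand is a constant times the density of a Gaussian of mean `y /
  -- v` and variance `(v + 1) / v`.
  have key : ∀ x, gaussianPDF 0 1 x *
        ENNReal.ofReal (Real.exp ((y + x) ^ 2 / (2 * (v + 1))) / √(v + 1))
      = ENNReal.ofReal (Real.exp (y ^ 2 / (2 * v)) / √v) * gaussianPDF (y / v) w x := by
    intro x
    rw [gaussianPDF, gaussianPDF, ← ENNReal.ofReal_mul (gaussianPDFReal_nonneg _ _ _),
      ← ENNReal.ofReal_mul (by positivity), gaussianPDFReal_def, gaussianPDFReal_def]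
    congr 1
    dsimp only
    rw [hwv]
    have hs : √(2 * Real.pi * ((v + 1) / v)) = √(2 * Real.pi) * (√(v + 1) / √v) := by
      rw [Real.sqrt_mul (by positivity), Real.sqrt_div hv1.le]
    have he : Real.exp (-(x - 0) ^ 2 / (2 * ((1 : NNReal) : ℝ)))
          * Real.exp ((y + x) ^ 2 / (2 * (v + 1)))
        = Real.exp (y ^ 2 / (2 * v)) * Real.exp (-(x - y / v) ^ 2 / (2 * ((v + 1) / v))) := by
      rw [← Real.exp_add, ← Real.exp_add]
      congr 1
      rw [NNReal.coe_one]
      field_simp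
      ring
    have h1 : √v ≠ 0 := (Real.sqrt_pos.2 hv).ne'
    have h2 : √(v + 1) ≠ 0 := (Real.sqrt_pos.2 hv1).ne'
    have h3 : √(2 * Real.pi) ≠ 0 := (Real.sqrt_pos.2 (by positivity)).ne'
    rw [hs, NNReal.coe_one, mul_one]
    rw [NNReal.coe_one] at he
    calc (√(2 * Real.pi))⁻¹ * Real.exp (-(x - 0) ^ 2 / (2 * 1)) *
          (Real.exp ((y + x) ^ 2 / (2 * (v + 1))) / √(v + 1))
        = (√(2 * Real.pi))⁻¹ / √(v + 1) * (Real.exp (-(x - 0) ^ 2 / (2 * 1))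
          * Real.exp ((y + x) ^ 2 / (2 * (v + 1)))) := by ring
      _ = _ := by rw [he]; field_simp
  rw [gaussianReal_of_var_ne_zero _ one_ne_zero,
    lintegral_withDensity_eq_lintegral_mul _ (measurable_gaussianPDF _ _) (by fun_prop)]
  simp only [Pi.mul_apply, key]
  rw [lintegral_const_mul _ (measurable_gaussianPDF _ _), lintegral_gaussianPDF_eq_one _ hw,
    mul_one]

lemma lintegral_gaussianReal_exp_sq_div_shift (m y v : ℝ) (hv : 0 < v) :
    ∫⁻ x, ENNReal.ofReal (Real.exp ((y + (x - m)) ^ 2 / (2 * (v + 1))) / √(v + 1))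
        ∂gaussianReal m 1
      = ENNReal.ofReal (Real.exp (y ^ 2 / (2 * v)) / √v) := by
  rw [← lintegral_gaussianReal_exp_sq_div y v hv]
  have h : gaussianReal m 1 = (gaussianReal 0 1).map (· + m) := by
    rw [gaussianReal_map_add_const, zero_add]
  rw [h, lintegral_map (by fun_prop) (by fun_prop)]
  simp

end Gaussian

/-! ### Joint law of parameter and history, and posterior sampling -/

section Interaction

variable {K : ℕ}

lemma sum_ofReal_policy (p : Policy K) : ∑ a, ENNReal.ofReal (p.1 a) = 1 := by
  rw [← ENNReal.ofReal_sum_of_nonneg fun a _ => p.2.1 a, p.2.2, ENNReal.ofReal_one]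

lemma lintegral_armKernel (p : Policy K) (g : Fin K → ℝ≥0∞) :
    ∫⁻ a, g a ∂armKernel K p = ∑ a, ENNReal.ofReal (p.1 a) * g a := by
  change ∫⁻ a, g a ∂(∑ a, ENNReal.ofReal (p.1 a) • Measure.dirac a) = _
  rw [lintegral_finsetSum_measure]
  simp [lintegral_smul_measure]

lemma measurable_lintegral_rewardKernel (θ : Params K) {g : Round K → ℝ≥0∞} (hg : Measurable g) :
    Measurable fun x : Policy K × Fin K => ∫⁻ r, g (x, r) ∂rewardKernel K (θ, x.2) :=
  Measurable.lintegral_kernel_prod_right'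
    (κ := (rewardKernel K).comap (fun x : Policy K × Fin K => (θ, x.2)) (by fun_prop)) hg

variable [NeZero K] (f : MeritFunction)

lemma lintegral_roundKernel {t : ℕ} (V : Kernel (History K t) (Params K)) [IsMarkovKernel V]
    (θ : Params K) (h : History K t) {g : Round K → ℝ≥0∞} (hg : Measurable g) :
    ∫⁻ r, g r ∂roundKernel f V (θ, h) = ∫⁻ μ, ∑ a, ENNReal.ofReal ((fairPolicy f μ).1 a) *
      ∫⁻ r, g ((fairPolicy f μ, a), r) ∂gaussianReal (θ a) 1 ∂V h := by
  have : IsMarkovKernel (V.map (fairPolicy f)) :=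
    Kernel.IsMarkovKernel.map V (measurable_fairPolicy f)
  have hm := measurable_lintegral_rewardKernel θ hg
  have hm1 : ∀ a, Measurable fun p : Policy K =>
      ENNReal.ofReal (p.1 a) * ∫⁻ r, g ((p, a), r) ∂rewardKernel K (θ, a) := fun a => by
    have h1 : Measurable fun p : Policy K => (p, a) := measurable_id.prodMk measurable_const
    have h2 := hm.comp h1
    exact (measurable_policy_apply a).ennreal_ofReal.mul h2
  have hm2 : Measurable fun p : Policy K => ∑ a, ENNReal.ofReal (p.1 a) *
      ∫⁻ r, g ((p, a), r) ∂rewardKernel K (θ, a) :=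
    Finset.measurable_sum Finset.univ fun a _ => hm1 a
  dsimp only [roundKernel]
  rw [Kernel.lintegral_compProd _ _ _ hg]
  dsimp only [Kernel.comap_apply]
  rw [Kernel.lintegral_compProd _ _ _ hm]
  dsimp only [Kernel.comap_apply]
  simp only [lintegral_armKernel]
  rw [Kernel.lintegral_map _ (measurable_fairPolicy f) _ hm2]
  rfl

variable (V : ∀ s, Kernel (History K s) (Params K)) [∀ s, IsMarkovKernel (V s)]

lemma lintegral_historyKernel_succ (t : ℕ) (θ : Params K) {g : History K (t + 1) → ℝ≥0∞}
    (hg : Measurable g) :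
    ∫⁻ h, g h ∂historyKernel f V (t + 1) θ
      = ∫⁻ h, ∫⁻ μ, ∑ a, ENNReal.ofReal ((fairPolicy f μ).1 a) *
          ∫⁻ r, g (Fin.snoc h ((fairPolicy f μ, a), r)) ∂gaussianReal (θ a) 1 ∂V t h
        ∂historyKernel f V t θ := by
  rw [historyKernel, extendKernel, Kernel.lintegral_map _ (measurable_snoc t) _ hg,
    Kernel.lintegral_compProd _ _ _ (f := fun x => g (Fin.snoc x.1 x.2))
      (hg.comp (measurable_snoc t))]
  refine lintegral_congr fun h => ?_
  exact lintegral_roundKernel f (V t) θ h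
    (hg.comp ((measurable_snoc t).comp (measurable_const.prodMk measurable_id)))

/-- The joint law of the true parameter and of the history of the first `t` rounds. -/
noncomputable def jointLaw (t : ℕ) : Measure (Params K × History K t) := prior K ⊗ₘ historyKernel f V t

instance (t : ℕ) : IsProbabilityMeasure (jointLaw f V t) := by unfold jointLaw; infer_instance

lemma lintegral_jointLaw (t : ℕ) {F : Params K × History K t → ℝ≥0∞} (hF : Measurable F) :
    ∫⁻ x, F x ∂jointLaw f V t = ∫⁻ θ, ∫⁻ h, F (θ, h) ∂historyKernel f V t θ ∂prior K :=
  Measure.lintegral_compProd hF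

omit [NeZero K] in
lemma measurable_policy_average (t : ℕ) {F : Params K × (Params K × History K t) → ℝ≥0∞}
    (hF : Measurable F) :
    Measurable fun x : Params K × History K t => ∫⁻ μ, F (μ, x) ∂V t x.2 :=
  Measurable.lintegral_kernel_prod_left'
    (κ := (V t).comap (Prod.snd : Params K × History K t → _) measurable_snd) hF

/-- If the integrand of the first `t + 1` rounds splits off the past and a function of the
deployed policy and the selected arm, so does the expectation. -/
lemma lintegral_jointLaw_succ (t : ℕ) {F : Params K × History K (t + 1) → ℝ≥0∞}
    {F₀ : Params K × History K t → ℝ≥0∞}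
    {D : Params K → Fin K → Params K × History K t → ℝ≥0∞}
    (hF : Measurable F) (hF₀ : Measurable F₀)
    (hD : ∀ a, Measurable fun y : Params K × (Params K × History K t) => D y.1 a y.2)
    (hFD : ∀ θ h μ a r, F (θ, Fin.snoc h ((fairPolicy f μ, a), r)) = F₀ (θ, h) + D μ a (θ, h)) :
    ∫⁻ x, F x ∂jointLaw f V (t + 1) = ∫⁻ x, F₀ x ∂jointLaw f V t +
      ∫⁻ x, ∫⁻ μ, ∑ a, ENNReal.ofReal ((fairPolicy f μ).1 a) * D μ a x ∂V t x.2
        ∂jointLaw f V t := by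
  rw [← lintegral_add_left hF₀, lintegral_jointLaw f V (t + 1) hF, lintegral_jointLaw]
  · refine lintegral_congr fun θ => ?_
    rw [lintegral_historyKernel_succ f V t θ (g := fun h => F (θ, h))
      (hF.comp (measurable_const.prodMk measurable_id))]
    refine lintegral_congr fun h => ?_
    have h1 : ∀ μ : Params K, ∑ a, ENNReal.ofReal ((fairPolicy f μ).1 a) *
          ∫⁻ r, F (θ, Fin.snoc h ((fairPolicy f μ, a), r)) ∂gaussianReal (θ a) 1
        = F₀ (θ, h) + ∑ a, ENNReal.ofReal ((fairPolicy f μ).1 a) * D μ a (θ, h) := by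
      intro μ
      simp only [hFD, lintegral_const, measure_univ, mul_one, mul_add, Finset.sum_add_distrib]
      rw [← Finset.sum_mul, sum_ofReal_policy, one_mul]
    simp only [h1]
    rw [lintegral_add_left measurable_const, lintegral_const, measure_univ, mul_one]
  · refine hF₀.add (measurable_policy_average V t
      (F := fun y => ∑ a, ENNReal.ofReal ((fairPolicy f y.1).1 a) * D y.1 a y.2) ?_)
    exact Finset.measurable_sum _ fun a _ => ((measurable_policy_apply a).comp
      ((measurable_fairPolicy f).comp measurable_fst)).ennreal_ofReal.mul (hD a)

/-- Under FairX-TS the sampled parameter and the true parameter have the same law jointly with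
the history. -/
lemma IsFairXTS.lintegral_sample {f : MeritFunction} {V : ∀ s, Kernel (History K s) (Params K)}
    [∀ s, IsMarkovKernel (V s)] (hV : IsFairXTS f V) (t : ℕ)
    {F : Params K × History K t → ℝ≥0∞} (hF : Measurable F) :
    ∫⁻ x, ∫⁻ μ, F (μ, x.2) ∂V t x.2 ∂jointLaw f V t = ∫⁻ x, F x ∂jointLaw f V t := by
  have hsnd : (jointLaw f V t).map Prod.snd = historyKernel f V t ∘ₘ prior K :=
    Measure.snd_compProd _ _
  have hm : Measurable fun h : History K t => ∫⁻ μ, F (μ, h) ∂V t h :=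
    Measurable.lintegral_kernel_prod_left' (κ := V t) hF
  have hs : Measurable fun y : History K t × Params K => F y.swap := hF.comp measurable_swap
  calc ∫⁻ x, ∫⁻ μ, F (μ, x.2) ∂V t x.2 ∂jointLaw f V t
      = ∫⁻ h, ∫⁻ μ, F (μ, h) ∂V t h ∂(historyKernel f V t ∘ₘ prior K) := by
        rw [← hsnd, lintegral_map hm measurable_snd]
    _ = ∫⁻ h, ∫⁻ μ, F (μ, h) ∂posterior (historyKernel f V t) (prior K) h
          ∂(historyKernel f V t ∘ₘ prior K) :=
        lintegral_congr_ae <| (hV t).mono fun h hh => by dsimp only; rw [hh]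
    _ = ∫⁻ y, F y.swap ∂((historyKernel f V t ∘ₘ prior K) ⊗ₘ
          posterior (historyKernel f V t) (prior K)) :=
        (Measure.lintegral_compProd (f := fun y => F y.swap) hs).symm
    _ = ∫⁻ x, F x ∂jointLaw f V t := by
        -- Bayes' rule: the history marginal followed by the posterior is the joint law with its
        -- coordinates swapped.
        rw [compProd_posterior_eq_map_swap,
          lintegral_map (f := fun y => F y.swap) hs measurable_swap]
        rfl

end Interaction

/-! ### Pull counts, the mixture martingale and the harmonic potential -/

section Statistics

variable {K t : ℕ}

/-- The number of times arm `a` was selected. -/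
def pullCount (a : Fin K) (h : History K t) : ℕ := ∑ s, if (h s).1.2 = a then 1 else 0

/-- The sum of the rewards observed from arm `a`. -/
noncomputable def rewardSum (a : Fin K) (h : History K t) : ℝ :=
  ∑ s, if (h s).1.2 = a then (h s).2 else 0

/-- The mean of the Gaussian posterior of arm `a`. -/
noncomputable def posteriorMean (h : History K t) : Params K :=
  fun a => rewardSum a h / (pullCount a h + 1)

/-- The deviation of the reward sum of arm `a` from the true parameter, including the prior. -/
noncomputable def deviation (a : Fin K) (x : Params K × History K t) : ℝ :=
  rewardSum a x.2 - (pullCount a x.2 + 1) * x.1 a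

/-- The method-of-mixtures martingale of arm `a`. -/
noncomputable def mixture (a : Fin K) (x : Params K × History K t) : ℝ :=
  Real.exp (deviation a x ^ 2 / (2 * (pullCount a x.2 + 2))) / √(pullCount a x.2 + 2)

/-- The harmonic potential of a history. -/
noncomputable def harmonicPotential (h : History K t) : ℝ :=
  ∑ a, (harmonic (pullCount a h) : ℝ)

lemma mixture_nonneg (a : Fin K) (x : Params K × History K t) : 0 ≤ mixture a x := by
  unfold mixture; positivity

lemma measurableSet_arm_eq (a : Fin K) (s : Fin t) :
    MeasurableSet {h : History K t | (h s).1.2 = a} := by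
  have : Measurable fun h : History K t => (h s).1.2 := by fun_prop
  exact this (measurableSet_singleton a)

@[fun_prop]
lemma measurable_pullCount (a : Fin K) : Measurable (pullCount a : History K t → ℕ) :=
  Finset.measurable_fun_sum _ fun s _ =>
    Measurable.ite (measurableSet_arm_eq a s) measurable_const measurable_const

@[fun_prop]
lemma measurable_pullCount_cast (a : Fin K) :
    Measurable fun h : History K t => (pullCount a h : ℝ) :=
  measurable_from_nat.comp (measurable_pullCount a)

@[fun_prop]
lemma measurable_rewardSum (a : Fin K) : Measurable (rewardSum a : History K t → ℝ) :=
  Finset.measurable_fun_sum _ fun s _ =>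
    Measurable.ite (measurableSet_arm_eq a s) (by fun_prop) measurable_const

@[fun_prop]
lemma measurable_posteriorMean : Measurable (posteriorMean : History K t → Params K) :=
  measurable_pi_lambda _ fun a => by unfold posteriorMean; fun_prop

@[fun_prop]
lemma measurable_mixture (a : Fin K) :
    Measurable (mixture a : Params K × History K t → ℝ) := by
  unfold mixture deviation; fun_prop

lemma measurable_harmonicPotential : Measurable (harmonicPotential : History K t → ℝ) :=
  Finset.measurable_fun_sum _ fun a _ =>
    (measurable_from_nat (f := fun n : ℕ => (harmonic n : ℝ))).comp (measurable_pullCount a)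

lemma pullCount_snoc (a b : Fin K) (h : History K t) (p : Policy K) (r : ℝ) :
    pullCount a (Fin.snoc h ((p, b), r) : History K (t + 1))
      = pullCount a h + if b = a then 1 else 0 := by
  simp only [pullCount, Fin.sum_univ_castSucc, Fin.snoc_castSucc, Fin.snoc_last]

lemma rewardSum_snoc (a b : Fin K) (h : History K t) (p : Policy K) (r : ℝ) :
    rewardSum a (Fin.snoc h ((p, b), r) : History K (t + 1))
      = rewardSum a h + if b = a then r else 0 := by
  simp only [rewardSum, Fin.sum_univ_castSucc, Fin.snoc_castSucc, Fin.snoc_last]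

lemma pullCount_le (a : Fin K) (h : History K t) : pullCount a h ≤ t := by
  calc pullCount a h ≤ ∑ _s : Fin t, 1 := Finset.sum_le_sum fun s _ => by split_ifs <;> simp
    _ = t := by simp

lemma harmonicPotential_snoc (b : Fin K) (h : History K t) (p : Policy K) (r : ℝ) :
    harmonicPotential (Fin.snoc h ((p, b), r) : History K (t + 1))
      = harmonicPotential h + 1 / ((pullCount b h : ℝ) + 1) := by
  have h1 : ∀ a, (harmonic (pullCount a (Fin.snoc h ((p, b), r) : History K (t + 1))) : ℝ)
      = harmonic (pullCount a h) + if b = a then 1 / ((pullCount a h : ℝ) + 1) else 0 := by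
    intro a
    rw [pullCount_snoc]
    split_ifs
    · rw [harmonic_succ]; push_cast; rw [one_div]
    · simp
  simp only [harmonicPotential, h1, Finset.sum_add_distrib, Finset.sum_ite_eq,
    Finset.mem_univ, if_true]

lemma harmonicPotential_nonneg (h : History K t) : 0 ≤ harmonicPotential h :=
  Finset.sum_nonneg fun a _ => by
    exact_mod_cast Finset.sum_nonneg fun i _ => by positivity

lemma harmonicPotential_le (h : History K t) :
    harmonicPotential h ≤ K * (1 + Real.log t) := by
  calc harmonicPotential h ≤ ∑ _a : Fin K, (1 + Real.log t) := by
        refine Finset.sum_le_sum fun a _ => (harmonic_le_one_add_log _).trans ?_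
        rcases Nat.eq_zero_or_pos (pullCount a h) with h0 | h0
        · rw [h0]
          simpa using Real.log_natCast_nonneg t
        · have : Real.log (pullCount a h) ≤ Real.log t :=
            Real.log_le_log (by exact_mod_cast h0) (by exact_mod_cast pullCount_le a h)
          linarith
    _ = K * (1 + Real.log t) := by simp [mul_add]

variable [NeZero K] (f : MeritFunction) (V : ∀ s, Kernel (History K s) (Params K))
  [∀ s, IsMarkovKernel (V s)]

/-- Martingale property: given `θ`, a pull of `a` adds a fresh standard normal `r - θ a` to the
deviation and raises the variance parameter `n + 2` by one, which is the Gaussian step above; other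
pulls change nothing. The value is that of the empty history, where the deviation is `-θ a`. -/
lemma lintegral_mixture_historyKernel (a : Fin K) (θ : Params K) (t : ℕ) :
    ∫⁻ h, ENNReal.ofReal (mixture a (θ, h)) ∂historyKernel f V t θ
      = ENNReal.ofReal (Real.exp ((θ a) ^ 2 / 4) / √2) := by
  induction t with
  | zero =>
    rw [historyKernel, Kernel.const_apply, lintegral_dirac' _ (by fun_prop)]
    simp only [mixture, deviation, rewardSum, pullCount, Finset.univ_eq_empty, Finset.sum_empty]
    norm_num
  | succ t ih =>
    rw [← ih, lintegral_historyKernel_succ f V t θ (by fun_prop)]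
    refine lintegral_congr fun h => ?_
    have h1 : ∀ (μ : Params K) (b : Fin K),
        ∫⁻ r, ENNReal.ofReal (mixture a (θ, (Fin.snoc h ((fairPolicy f μ, b), r) :
          History K (t + 1)))) ∂gaussianReal (θ b) 1 = ENNReal.ofReal (mixture a (θ, h)) := by
      intro μ b
      simp only [mixture, deviation, rewardSum_snoc, pullCount_snoc]
      split_ifs with hb
      · subst hb
        rw [← lintegral_gaussianReal_exp_sq_div_shift (θ b)
          (rewardSum b h - (pullCount b h + 1) * θ b) (pullCount b h + 2) (by positivity)]
        refine lintegral_congr fun r => ?_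
        have e1 : ((pullCount b h + 1 : ℕ) : ℝ) + 2 = pullCount b h + 2 + 1 := by push_cast; ring
        have e2 : rewardSum b h + r - (((pullCount b h + 1 : ℕ) : ℝ) + 1) * θ b
            = rewardSum b h - (pullCount b h + 1) * θ b + (r - θ b) := by push_cast; ring
        rw [e1, e2]
      · simp
    simp only [h1]
    simp only [← Finset.sum_mul, sum_ofReal_policy, one_mul, lintegral_const, measure_univ,
      mul_one]

/-- The prior draw of `θ a` acts as one more Gaussian step, started from `y = 0`, `v = 1`. This is
why the mixture carries `n + 2`: one unit for the mixing variance and one for the prior. -/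
lemma lintegral_mixture (a : Fin K) (t : ℕ) :
    ∫⁻ x, ENNReal.ofReal (mixture a x) ∂jointLaw f V t = 1 := by
  rw [lintegral_jointLaw f V t (by fun_prop)]
  simp only [lintegral_mixture_historyKernel]
  have hmp : MeasurePreserving (Function.eval a) (prior K) (gaussianReal 0 1) :=
    measurePreserving_eval (fun _ : Fin K => gaussianReal 0 1) a
  have h := lintegral_gaussianReal_exp_sq_div 0 1 one_pos
  norm_num at h
  rw [← h]
  exact hmp.lintegral_comp (f := fun x => ENNReal.ofReal (Real.exp (x ^ 2 / 4) / √2))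
    (by fun_prop)

/-- The expected harmonic potential increases by the expected inverse count of the selected arm. -/
lemma lintegral_harmonicPotential_succ (t : ℕ) :
    ∫⁻ x, ENNReal.ofReal (harmonicPotential x.2) ∂jointLaw f V (t + 1)
      = ∫⁻ x, ENNReal.ofReal (harmonicPotential x.2) ∂jointLaw f V t
        + ∫⁻ x, ∫⁻ μ, ∑ a, ENNReal.ofReal ((fairPolicy f μ).1 a)
            * ENNReal.ofReal (1 / ((pullCount a x.2 : ℝ) + 1)) ∂V t x.2 ∂jointLaw f V t := by
  refine lintegral_jointLaw_succ f V t
    (D := fun _ a x => ENNReal.ofReal (1 / ((pullCount a x.2 : ℝ) + 1)))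
    (measurable_harmonicPotential.comp measurable_snd).ennreal_ofReal
    (measurable_harmonicPotential.comp measurable_snd).ennreal_ofReal
    (fun a => by fun_prop) fun θ h μ a r => ?_
  dsimp only
  rw [harmonicPotential_snoc, ENNReal.ofReal_add (harmonicPotential_nonneg h) (by positivity)]

lemma lintegral_harmonicPotential_le (t : ℕ) :
    ∫⁻ x, ENNReal.ofReal (harmonicPotential x.2) ∂jointLaw f V t
      ≤ ENNReal.ofReal (K * (1 + Real.log t)) := by
  calc _ ≤ ∫⁻ _x, ENNReal.ofReal (K * (1 + Real.log t)) ∂jointLaw f V t :=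
        lintegral_mono fun x => ENNReal.ofReal_le_ofReal (harmonicPotential_le x.2)
    _ = _ := by simp

end Statistics

/-! ### Pointwise bounds on the distance between fair policies -/

section Pointwise

variable {K t : ℕ} [NeZero K] (f : MeritFunction)

/-- The changes of the numerators and of the normaliser each cost at most `Δ / S`. The factor `1 ≤ f
(θ a) / γ` then turns the plain sum of errors into an average under the policy of `θ`, the form in
which posterior sampling can exchange policies. -/
lemma sum_abs_fairPolicy_sub_le {γ L : ℝ} (hγ : 0 < γ) (hL : 0 < L) (hmin : ∀ x, γ ≤ f x)
    (hlip : ∀ x y, |f x - f y| ≤ L * |x - y|) (θ m : Params K) :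
    ∑ a, |(fairPolicy f θ).1 a - (fairPolicy f m).1 a|
      ≤ 2 * L / γ * ∑ a, (fairPolicy f θ).1 a * |θ a - m a| := by
  have hS : 0 < ∑ b, f (θ b) := sum_merit_pos f θ
  have hS' : 0 < ∑ b, f (m b) := sum_merit_pos f m
  set S := ∑ b, f (θ b) with hSdef
  set S' := ∑ b, f (m b) with hSdef'
  set Δ := ∑ b, |f (θ b) - f (m b)| with hΔ
  have hSS : |S' - S| ≤ Δ := by
    rw [hSdef, hSdef', ← Finset.sum_sub_distrib]
    refine (Finset.abs_sum_le_sum_abs _ _).trans (Finset.sum_le_sum fun b _ => ?_)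
    rw [abs_sub_comm]
  have h1 : ∀ a, |(fairPolicy f θ).1 a - (fairPolicy f m).1 a|
      ≤ |f (θ a) - f (m a)| / S + (fairPolicy f m).1 a * (Δ / S) := by
    intro a
    -- Dividing by `S` rather than `S'` keeps the normaliser of `θ`; the correction is weighted by
    -- the policy of `m`, which sums to 1.
    have e : (fairPolicy f θ).1 a - (fairPolicy f m).1 a
        = (f (θ a) - f (m a)) / S + (fairPolicy f m).1 a * ((S' - S) / S) := by
      change f (θ a) / S - f (m a) / S' = _ + f (m a) / S' * _
      field_simp
      ring
    rw [e]
    refine (abs_add_le _ _).trans ?_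
    rw [abs_div, abs_mul, abs_div, abs_of_pos hS, abs_of_nonneg ((fairPolicy f m).2.1 a)]
    have := (fairPolicy f m).2.1 a
    gcongr
  have h2 : ∑ a, |(fairPolicy f θ).1 a - (fairPolicy f m).1 a| ≤ 2 * (Δ / S) := by
    refine (Finset.sum_le_sum fun a _ => h1 a).trans (le_of_eq ?_)
    rw [Finset.sum_add_distrib, ← Finset.sum_div, ← Finset.sum_mul]
    have : ∑ a, (fairPolicy f m).1 a = 1 := (fairPolicy f m).2.2
    rw [this]
    ring
  have h3 : Δ / S ≤ ∑ a, L / γ * ((fairPolicy f θ).1 a * |θ a - m a|) := by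
    rw [hΔ, Finset.sum_div]
    refine Finset.sum_le_sum fun a _ => ?_
    change _ ≤ L / γ * (f (θ a) / S * _)
    have e : L / γ * (f (θ a) / S * |θ a - m a|) = (f (θ a) / γ * (L * |θ a - m a|)) / S := by
      field_simp
    rw [e]
    refine div_le_div_of_nonneg_right ((hlip _ _).trans ?_) hS.le
    exact le_mul_of_one_le_left (by positivity) ((one_le_div hγ).2 (hmin _))
  calc _ ≤ 2 * (Δ / S) := h2
    _ ≤ 2 * ∑ a, L / γ * ((fairPolicy f θ).1 a * |θ a - m a|) := by gcongr
    _ = _ := by rw [← Finset.mul_sum]; ring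

/-- AM-GM, with the squared error controlled by the exponent of the mixture. Dividing the mixture by
`K` costs `log K` but makes the sum over all arms have bounded expectation, in place of a union
bound. -/
lemma abs_sub_posteriorMean_le (a : Fin K) (x : Params K × History K t) {ε : ℝ} (hε : 0 < ε) :
    |x.1 a - posteriorMean x.2 a|
      ≤ 2 * ε * (Real.log K + Real.log (t + 2) / 2 + mixture a x / K)
        + 1 / (2 * ε) * (1 / ((pullCount a x.2 : ℝ) + 1)) := by
  have hK : (0 : ℝ) < K := by exact_mod_cast Nat.pos_of_ne_zero (NeZero.ne K)
  set n : ℝ := (pullCount a x.2 : ℝ) with hn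
  have hn0 : 0 ≤ n := by positivity
  have hnt : n ≤ t := by rw [hn]; exact_mod_cast pullCount_le a x.2
  set w := |x.1 a - posteriorMean x.2 a| with hw
  set X := deviation a x ^ 2 / (2 * (n + 2)) with hX
  have hdev : deviation a x = -((n + 1) * (x.1 a - posteriorMean x.2 a)) := by
    simp only [deviation, posteriorMean, ← hn]
    field_simp
    ring
  -- Uses `n + 2 ≤ 2 (n + 1)`.
  have hXw : (n + 1) * w ^ 2 / 4 ≤ X := by
    rw [hX, hdev, hw, sq_abs, neg_sq, mul_pow, div_le_div_iff₀ (by norm_num) (by positivity)]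
    have : 0 ≤ (n + 1) * (x.1 a - posteriorMean x.2 a) ^ 2 := by positivity
    nlinarith
  have hamgm : w ≤ ε * ((n + 1) * w ^ 2) / 2 + 1 / (2 * ε) * (1 / (n + 1)) := by
    have e : ε * ((n + 1) * w ^ 2) / 2 + 1 / (2 * ε) * (1 / (n + 1)) - w
        = (ε * (n + 1) * w - 1) ^ 2 / (2 * ε * (n + 1)) := by
      field_simp
      ring
    have : 0 ≤ (ε * (n + 1) * w - 1) ^ 2 / (2 * ε * (n + 1)) := by positivity
    linarith
  have hlog : X ≤ Real.log K + Real.log (t + 2) / 2 + mixture a x / K := by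
    have hM : mixture a x = Real.exp X / √(n + 2) := rfl
    have hMpos : 0 < mixture a x := by rw [hM]; positivity
    -- Apply `log z ≤ z - 1` at `z = mixture a x / K`, so that the mixture enters linearly and can
    -- be integrated.
    have h1 := Real.log_le_sub_one_of_pos (div_pos hMpos hK)
    rw [Real.log_div hMpos.ne' hK.ne', hM, Real.log_div (Real.exp_pos _).ne' (by positivity),
      Real.log_exp, Real.log_sqrt (by positivity), ← hM] at h1
    have h2 : Real.log (n + 2) ≤ Real.log (t + 2) :=
      Real.log_le_log (by positivity) (by linarith)
    linarith
  have : ε * ((n + 1) * w ^ 2) / 2 ≤ 2 * ε * X := by nlinarith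
  have : 2 * ε * X ≤ 2 * ε * (Real.log K + Real.log (t + 2) / 2 + mixture a x / K) := by gcongr
  linarith

lemma sum_fairPolicy_mul_abs_sub_posteriorMean_le (x : Params K × History K t) {ε : ℝ}
    (hε : 0 < ε) :
    ∑ a, (fairPolicy f x.1).1 a * |x.1 a - posteriorMean x.2 a|
      ≤ 2 * ε * (Real.log K + Real.log (t + 2) / 2) + 2 * ε / K * ∑ a, mixture a x
        + 1 / (2 * ε) * ∑ a, (fairPolicy f x.1).1 a * (1 / ((pullCount a x.2 : ℝ) + 1)) := by
  have hp0 := (fairPolicy f x.1).2.1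
  have hp1 : ∑ a, (fairPolicy f x.1).1 a = 1 := (fairPolicy f x.1).2.2
  have hle : ∀ a, (fairPolicy f x.1).1 a ≤ 1 := fun a => by
    rw [← hp1]
    exact Finset.single_le_sum (fun b _ => hp0 b) (Finset.mem_univ a)
  calc ∑ a, (fairPolicy f x.1).1 a * |x.1 a - posteriorMean x.2 a|
      ≤ ∑ a, ((fairPolicy f x.1).1 a * (2 * ε * (Real.log K + Real.log (t + 2) / 2))
          + 2 * ε / K * mixture a x
          + 1 / (2 * ε) * ((fairPolicy f x.1).1 a * (1 / ((pullCount a x.2 : ℝ) + 1)))) := by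
        refine Finset.sum_le_sum fun a _ => ?_
        have h1 := mul_le_mul_of_nonneg_left (abs_sub_posteriorMean_le a x hε) (hp0 a)
        -- Policy and mixture both depend on the parameter, so the weight is bounded by 1 here; it
        -- is kept on the inverse counts, where it is needed.
        have h2 : (fairPolicy f x.1).1 a * (2 * ε / K * mixture a x) ≤ 2 * ε / K * mixture a x :=
          mul_le_of_le_one_left (mul_nonneg (by positivity) (mixture_nonneg a x)) (hle a)
        refine h1.trans (le_trans (le_of_eq ?_) (add_le_add (add_le_add le_rfl h2) le_rfl))
        ring
    _ = _ := by
        rw [Finset.sum_add_distrib, Finset.sum_add_distrib, ← Finset.sum_mul, hp1,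
          ← Finset.mul_sum, ← Finset.mul_sum, one_mul]

end Pointwise

/-! ### Regret per round and its accumulation -/

section Regret

variable {K : ℕ} [NeZero K] (f : MeritFunction)

@[fun_prop]
lemma measurable_fairPolicy_apply (a : Fin K) :
    Measurable fun θ : Params K => (fairPolicy f θ).1 a :=
  (measurable_policy_apply a).comp (measurable_fairPolicy f)

lemma measurable_fairnessRegret (t : ℕ) :
    Measurable fun x : Params K × History K t => fairnessRegret f x.1 x.2 := by
  unfold fairnessRegret
  have h : ∀ (s : Fin t) (a : Fin K),
      Measurable fun x : Params K × History K t => (x.2 s).1.1.1 a := fun s a =>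
    (measurable_policy_apply a).comp (by fun_prop)
  fun_prop

lemma fairnessRegret_nonneg {t : ℕ} (θ : Params K) (h : History K t) :
    0 ≤ fairnessRegret f θ h :=
  Finset.sum_nonneg fun _ _ => Finset.sum_nonneg fun _ _ => abs_nonneg _

lemma fairnessRegret_snoc {t : ℕ} (θ : Params K) (h : History K t) (p : Policy K) (b : Fin K)
    (r : ℝ) :
    fairnessRegret f θ (Fin.snoc h ((p, b), r) : History K (t + 1))
      = fairnessRegret f θ h + ∑ a, |(fairPolicy f θ).1 a - p.1 a| := by
  simp only [fairnessRegret, Fin.sum_univ_castSucc, Fin.snoc_castSucc, Fin.snoc_last]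

variable (V : ∀ s, Kernel (History K s) (Params K)) [∀ s, IsMarkovKernel (V s)]

lemma bayesFairnessRegret_eq_lintegral (t : ℕ) :
    bayesFairnessRegret f V t
      = ∫⁻ x, ENNReal.ofReal (fairnessRegret f x.1 x.2) ∂jointLaw f V t := by
  rw [lintegral_jointLaw f V t (measurable_fairnessRegret f t).ennreal_ofReal,
    bayesFairnessRegret]

lemma bayesFairnessRegret_zero : bayesFairnessRegret f V 0 = 0 := by
  simp [bayesFairnessRegret, fairnessRegret]

lemma bayesFairnessRegret_succ (t : ℕ) :
    bayesFairnessRegret f V (t + 1) = bayesFairnessRegret f V t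
      + ∫⁻ x, ∫⁻ μ, ENNReal.ofReal (∑ a, |(fairPolicy f x.1).1 a - (fairPolicy f μ).1 a|)
          ∂V t x.2 ∂jointLaw f V t := by
  rw [bayesFairnessRegret_eq_lintegral, bayesFairnessRegret_eq_lintegral,
    lintegral_jointLaw_succ f V t
      (F₀ := fun x => ENNReal.ofReal (fairnessRegret f x.1 x.2))
      (D := fun μ _ x =>
        ENNReal.ofReal (∑ a, |(fairPolicy f x.1).1 a - (fairPolicy f μ).1 a|))
      (measurable_fairnessRegret f (t + 1)).ennreal_ofReal
      (measurable_fairnessRegret f t).ennreal_ofReal (fun a => by fun_prop)]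
  · simp only [← Finset.sum_mul, sum_ofReal_policy, one_mul]
  · intro θ h μ a r
    dsimp only
    rw [fairnessRegret_snoc, ENNReal.ofReal_add (fairnessRegret_nonneg f θ h)
      (Finset.sum_nonneg fun _ _ => abs_nonneg _)]

variable {f V}

/-- The expected `ℓ¹` distance between the optimal fair policy and the fair policy of the
posterior mean. -/
lemma lintegral_fairPolicy_sub_posteriorMean_le {γ L : ℝ} (hγ : 0 < γ) (hL : 0 < L)
    (hmin : ∀ x, γ ≤ f x) (hlip : ∀ x y, |f x - f y| ≤ L * |x - y|) (hV : IsFairXTS f V)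
    {ε : ℝ} (hε : 0 < ε) (t : ℕ) :
    ∫⁻ x, ENNReal.ofReal (∑ a, |(fairPolicy f x.1).1 a
        - (fairPolicy f (posteriorMean x.2)).1 a|) ∂jointLaw f V t
      ≤ ENNReal.ofReal (2 * L / γ) *
        (ENNReal.ofReal (2 * ε * (Real.log K + Real.log (t + 2) / 2 + 1))
          + ENNReal.ofReal (1 / (2 * ε)) *
            ∫⁻ x, ∫⁻ μ, ∑ a, ENNReal.ofReal ((fairPolicy f μ).1 a)
              * ENNReal.ofReal (1 / ((pullCount a x.2 : ℝ) + 1)) ∂V t x.2 ∂jointLaw f V t) := by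
  have hK : (0 : ℝ) < K := by exact_mod_cast Nat.pos_of_ne_zero (NeZero.ne K)
  have hlogK : 0 ≤ Real.log K := Real.log_natCast_nonneg K
  have hlogt : 0 ≤ Real.log ((t : ℝ) + 2) := Real.log_nonneg (by
    have : (0 : ℝ) ≤ t := by positivity
    linarith)
  set b := 2 * ε * (Real.log K + Real.log (t + 2) / 2) with hb
  have hb0 : 0 ≤ b := by positivity
  -- The counts depend only on the history, so the sampled policy may be replaced by the optimal
  -- one; what remains is a pointwise inequality.
  rw [hV.lintegral_sample t (F := fun x => ∑ a, ENNReal.ofReal ((fairPolicy f x.1).1 a)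
    * ENNReal.ofReal (1 / ((pullCount a x.2 : ℝ) + 1))) (by fun_prop)]
  have hpt : ∀ x : Params K × History K t,
      ENNReal.ofReal (∑ a, |(fairPolicy f x.1).1 a - (fairPolicy f (posteriorMean x.2)).1 a|)
        ≤ ENNReal.ofReal (2 * L / γ) * (ENNReal.ofReal b
          + ENNReal.ofReal (2 * ε / K) * ∑ a, ENNReal.ofReal (mixture a x)
          + ENNReal.ofReal (1 / (2 * ε)) * ∑ a, ENNReal.ofReal ((fairPolicy f x.1).1 a)
              * ENNReal.ofReal (1 / ((pullCount a x.2 : ℝ) + 1))) := by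
    intro x
    have hp0 := (fairPolicy f x.1).2.1
    have hs1 : 0 ≤ ∑ a, mixture a x := Finset.sum_nonneg fun a _ => mixture_nonneg a x
    have hs2 : 0 ≤ ∑ a, (fairPolicy f x.1).1 a * (1 / ((pullCount a x.2 : ℝ) + 1)) :=
      Finset.sum_nonneg fun a _ => mul_nonneg (hp0 a) (by positivity)
    have e : ∀ a, ENNReal.ofReal ((fairPolicy f x.1).1 a)
          * ENNReal.ofReal (1 / ((pullCount a x.2 : ℝ) + 1))
        = ENNReal.ofReal ((fairPolicy f x.1).1 a * (1 / ((pullCount a x.2 : ℝ) + 1))) :=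
      fun a => (ENNReal.ofReal_mul (hp0 a)).symm
    simp only [e]
    rw [← ENNReal.ofReal_sum_of_nonneg fun a _ => mixture_nonneg a x,
      ← ENNReal.ofReal_sum_of_nonneg fun a _ => mul_nonneg (hp0 a) (by positivity),
      ← ENNReal.ofReal_mul (by positivity), ← ENNReal.ofReal_mul (by positivity),
      ← ENNReal.ofReal_add hb0 (by positivity), ← ENNReal.ofReal_add (by positivity)
        (by positivity), ← ENNReal.ofReal_mul (by positivity)]
    refine ENNReal.ofReal_le_ofReal ?_
    refine (sum_abs_fairPolicy_sub_le f hγ hL hmin hlip _ _).trans ?_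
    exact mul_le_mul_of_nonneg_left (sum_fairPolicy_mul_abs_sub_posteriorMean_le f x hε)
      (by positivity)
  refine (lintegral_mono hpt).trans ?_
  rw [lintegral_const_mul _ (by fun_prop), lintegral_add_left (by fun_prop),
    lintegral_add_left measurable_const, lintegral_const_mul _ (by fun_prop),
    lintegral_const_mul _ (by fun_prop), lintegral_finsetSum _ (fun a _ => by fun_prop)]
  simp only [lintegral_mixture, lintegral_const, measure_univ, mul_one, Finset.sum_const,
    Finset.card_univ, Fintype.card_fin, nsmul_eq_mul]
  -- The `+ 1` is the contribution of the `K` mixtures, each of mean 1, with coefficient `2 * ε /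
  -- K`.
  have e : ENNReal.ofReal (2 * ε * (Real.log K + Real.log (t + 2) / 2 + 1))
      = ENNReal.ofReal b + ENNReal.ofReal (2 * ε / K) * (K : ℝ≥0∞) := by
    rw [← ENNReal.ofReal_natCast K, ← ENNReal.ofReal_mul (by positivity),
      ← ENNReal.ofReal_add hb0 (by positivity), hb]
    congr 1
    field_simp
  rw [e]

/-- The expected regret of one round. -/
lemma lintegral_fairPolicy_sub_sample_le (hV : IsFairXTS f V) (t : ℕ) :
    ∫⁻ x, ∫⁻ μ, ENNReal.ofReal (∑ a, |(fairPolicy f x.1).1 a - (fairPolicy f μ).1 a|)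
        ∂V t x.2 ∂jointLaw f V t
      ≤ 2 * ∫⁻ x, ENNReal.ofReal (∑ a, |(fairPolicy f x.1).1 a
          - (fairPolicy f (posteriorMean x.2)).1 a|) ∂jointLaw f V t := by
  let A : Params K × History K t → ℝ≥0∞ := fun x =>
    ENNReal.ofReal (∑ a, |(fairPolicy f x.1).1 a - (fairPolicy f (posteriorMean x.2)).1 a|)
  have hA : Measurable A := by fun_prop
  have hpt : ∀ (x : Params K × History K t) (μ : Params K),
      ENNReal.ofReal (∑ a, |(fairPolicy f x.1).1 a - (fairPolicy f μ).1 a|)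
        ≤ A x + A (μ, x.2) := by
    intro x μ
    rw [← ENNReal.ofReal_add (Finset.sum_nonneg fun _ _ => abs_nonneg _)
      (Finset.sum_nonneg fun _ _ => abs_nonneg _), ← Finset.sum_add_distrib]
    refine ENNReal.ofReal_le_ofReal (Finset.sum_le_sum fun a _ => ?_)
    rw [abs_sub_comm ((fairPolicy f μ).1 a)]
    exact abs_sub_le _ _ _
  calc _ ≤ ∫⁻ x, ∫⁻ μ, (A x + A (μ, x.2)) ∂V t x.2 ∂jointLaw f V t :=
        lintegral_mono fun x => lintegral_mono fun μ => hpt x μ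
    _ = ∫⁻ x, (A x + ∫⁻ μ, A (μ, x.2) ∂V t x.2) ∂jointLaw f V t := by
        refine lintegral_congr fun x => ?_
        rw [lintegral_add_left measurable_const, lintegral_const, measure_univ, mul_one]
    -- The second term is the first with the truth replaced by the sample, so posterior sampling
    -- makes them equal.
    _ = 2 * ∫⁻ x, A x ∂jointLaw f V t := by
        rw [lintegral_add_left hA, hV.lintegral_sample t hA, two_mul]

/-- The inverse-count term of each round is exactly the expected increment of the potential, so
induction telescopes it. The horizon `T` is kept apart from `t` so that one logarithmic bound serves
every round. -/
lemma bayesFairnessRegret_le {γ L : ℝ} (hγ : 0 < γ) (hL : 0 < L)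
    (hmin : ∀ x, γ ≤ f x) (hlip : ∀ x y, |f x - f y| ≤ L * |x - y|) (hV : IsFairXTS f V)
    {ε : ℝ} (hε : 0 < ε) {T t : ℕ} (ht : t ≤ T) :
    bayesFairnessRegret f V t ≤ 2 * ENNReal.ofReal (2 * L / γ) *
      (t * ENNReal.ofReal (2 * ε * (Real.log K + Real.log (T + 1) / 2 + 1))
        + ENNReal.ofReal (1 / (2 * ε)) *
          ∫⁻ x, ENNReal.ofReal (harmonicPotential x.2) ∂jointLaw f V t) := by
  induction t with
  | zero => simp [bayesFairnessRegret_zero]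
  | succ t ih =>
    have hlog : Real.log ((t : ℝ) + 2) ≤ Real.log (T + 1) := by
      have : ((t + 1 : ℕ) : ℝ) ≤ T := by exact_mod_cast ht
      push_cast at this
      exact Real.log_le_log (by positivity) (by linarith)
    have hb : ENNReal.ofReal (2 * ε * (Real.log K + Real.log (t + 2) / 2 + 1))
        ≤ ENNReal.ofReal (2 * ε * (Real.log K + Real.log (T + 1) / 2 + 1)) :=
      ENNReal.ofReal_le_ofReal (by gcongr)
    have hround := (lintegral_fairPolicy_sub_sample_le hV t).trans (mul_le_mul_right
      ((lintegral_fairPolicy_sub_posteriorMean_le hγ hL hmin hlip hV hε t).trans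
        (mul_le_mul_right (add_le_add_left hb _) _)) 2)
    rw [bayesFairnessRegret_succ, lintegral_harmonicPotential_succ]
    refine (add_le_add (ih (by omega)) hround).trans (le_of_eq ?_)
    push_cast
    ring

end Regret

/-! ### Tuning `ε` and the final bound -/

/-- The numerical estimate behind the choice `ε = √(K / T)`. -/
lemma regret_bound_le {c K T : ℝ} (hc : 0 ≤ c) (hK : 1 ≤ K) (hT : 1 ≤ T) :
    2 * c * (T * (2 * √(K / T) * (Real.log K + Real.log (T + 1) / 2 + 1))
        + 1 / (2 * √(K / T)) * (K * (1 + Real.log T)))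
      ≤ 8 * c * √(K * T) * (1 + Real.log (K * T)) := by
  have hK0 : 0 < K := by linarith
  have hT0 : 0 < T := by linarith
  have hsK : 0 < √K := Real.sqrt_pos.2 hK0
  have hsT : 0 < √T := Real.sqrt_pos.2 hT0
  have hlogK : 0 ≤ Real.log K := Real.log_nonneg hK
  have hlogT : 0 ≤ Real.log T := Real.log_nonneg hT
  have hlogT1 : Real.log (T + 1) ≤ 1 + Real.log T := by
    calc Real.log (T + 1) ≤ Real.log (2 * T) := Real.log_le_log (by linarith) (by linarith)
      _ = Real.log 2 + Real.log T := Real.log_mul (by norm_num) hT0.ne'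
      _ ≤ 1 + Real.log T := by linarith [Real.log_two_lt_d9]
  have e1 : T * √(K / T) = √(K * T) := by
    rw [Real.sqrt_div hK0.le, Real.sqrt_mul hK0.le]
    nth_rewrite 1 [← Real.mul_self_sqrt hT0.le]
    field_simp
  have e2 : 1 / (2 * √(K / T)) * K = √(K * T) / 2 := by
    rw [Real.sqrt_div hK0.le, Real.sqrt_mul hK0.le]
    nth_rewrite 2 [← Real.mul_self_sqrt hK0.le]
    field_simp
  calc _ = 2 * c * (2 * (T * √(K / T)) * (Real.log K + Real.log (T + 1) / 2 + 1)
        + 1 / (2 * √(K / T)) * K * (1 + Real.log T)) := by ring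
    _ = 2 * c * √(K * T) * (2 * Real.log K + Real.log (T + 1) + 2 + (1 + Real.log T) / 2) := by
        rw [e1, e2]; ring
    -- With `log (T + 1) ≤ 1 + log T` the bracket is at most `2 log K + (3/2) log T + 7/2`.
    _ ≤ 2 * c * √(K * T) * (4 * (1 + Real.log (K * T))) := by
        rw [Real.log_mul hK0.ne' hT0.ne']
        gcongr
        linarith
    _ = _ := by ring

end FairBandit

theorem theorem6 :
    ∃ C : ℝ, 0 < C ∧ ∃ p : ℕ,
      ∀ (K : ℕ) [NeZero K] (f : FairBandit.MeritFunction) (γ L : ℝ),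
        0 < γ → 0 < L →
        (∀ x, γ ≤ f x) →
        (∀ x y, |f x - f y| ≤ L * |x - y|) →
        ∀ (V : ∀ s, Kernel (FairBandit.History K s) (FairBandit.Params K))
          [∀ s, IsMarkovKernel (V s)],
          FairBandit.IsFairXTS f V →
          ∀ T : ℕ, 1 ≤ T →
            FairBandit.bayesFairnessRegret f V T ≤
              ENNReal.ofReal
                (C * (L * Real.sqrt (K * T) / γ) * (1 + Real.log (K * T)) ^ p) := by
  -- The constant is the 8 of `regret_bound_le` times the 2 in `c = 2 * L / γ`; one logarithm
  -- suffices.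
  refine ⟨16, by norm_num, 1, ?_⟩
  intro K _ f γ L hγ hL hmin hlip V _ hV T hT
  have hK : (1 : ℝ) ≤ K := by exact_mod_cast Nat.pos_of_ne_zero (NeZero.ne K)
  have hT1 : (1 : ℝ) ≤ T := by exact_mod_cast hT
  have hε : 0 < √((K : ℝ) / T) := Real.sqrt_pos.2 (by positivity)
  have hlogK : 0 ≤ Real.log K := Real.log_nonneg hK
  have hlogT : 0 ≤ Real.log T := Real.log_nonneg hT1
  have hlogT1 : 0 ≤ Real.log ((T : ℝ) + 1) := Real.log_nonneg (by linarith)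
  have h := FairBandit.bayesFairnessRegret_le hγ hL hmin hlip hV hε (le_refl T)
  refine h.trans ?_
  refine (mul_le_mul_right (add_le_add_right (mul_le_mul_right
    (FairBandit.lintegral_harmonicPotential_le f V T) _) _) _).trans ?_
  rw [← ENNReal.ofReal_ofNat 2, ← ENNReal.ofReal_natCast T, ← ENNReal.ofReal_mul (by norm_num),
    ← ENNReal.ofReal_mul (by positivity), ← ENNReal.ofReal_mul (by positivity),
    ← ENNReal.ofReal_add (by positivity) (by positivity), ← ENNReal.ofReal_mul (by positivity)]
  refine ENNReal.ofReal_le_ofReal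
    ((FairBandit.regret_bound_le (c := 2 * L / γ) (by positivity) hK hT1).trans (le_of_eq ?_))
  ring
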